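/- Let $M$ be a smooth manifold of dimension $n\ge 2$ with a volume form $\Omega$ that is exact, $\Omega=d\alpha$ for a fixed smooth $(n-1)$-form $\alpha$. Call a smooth vector field $X$ on $M$ \emph{exact incompressible} if $i_X\Omega$ is exact, i.e. $i_X\Omega=d\gamma$ for some smooth $(n-2)$-form $\gamma$; a smooth $(n-2)$-form $\beta_X$ with $L_X\alpha=d\beta_X$ is called a \emph{structure form} of $X$ (here $L_X$ is the Lie derivative). A diffeomorphism $f:M\to M$ is \emph{exact volume-preserving} if $f^*\alpha-\alpha=d\lambda$ for some smooth $(n-2)$-form $\lambda$. Let $X,Y,Z$ be exact incompressible vector fields with structure forms $\beta_X,\beta_Y,\beta_Z$. Then: 1. the Lie bracket $[X,Y]$ is an exact incompressible vector field with structure form $L_X\beta_Y-L_Y\beta_X$; 2. if $f:M\to M$ is an exact volume-preserving diffeomorphism with $f^*\alpha-\alpha=d\lambda$, then the pull-back $f^*Z=(Df)^{-1}\,(Z\circ f)$ is an exact incompressible vector field with structure form $f^*\beta_Z-L_{f^*Z}\lambda$. -/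

import Mathlib

open Set Filter Topology
open scoped Manifold ContDiff

noncomputable section

namespace ExactVol

section NormedSpace

variable {E : Type*} [NormedAddCommGroup E] [NormedSpace ℝ E]

/-- Lie derivative, within a set `s`, of a differential `k`-form on a normed space along a vector
field: `(L_X η)(x; v₁, …, v_k) = (D_x η · X(x))(v₁, …, v_k) + ∑ᵢ η(x; v₁, …, D_x X · vᵢ, …, v_k)`,
see `lieDerivWithin_apply`. It is the derivative at `t = 0` of the pullback of `η` by the flow
of `X`, see `hasDerivAt_pullback_flow`. -/
def lieDerivWithin {k : ℕ} (X : E → E) (η : E → E [⋀^Fin k]→L[ℝ] ℝ) (s : Set E) (x : E) :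
    E [⋀^Fin k]→L[ℝ] ℝ :=
  fderivWithin ℝ η s x (X x) +
    (η x).fderivCompContinuousLinearMap (ContinuousLinearMap.id ℝ E) (fderivWithin ℝ X s x)

theorem lieDerivWithin_apply {k : ℕ} (X : E → E) (η : E → E [⋀^Fin k]→L[ℝ] ℝ) (s : Set E) (x : E)
    (v : Fin k → E) :
    lieDerivWithin X η s x v = fderivWithin ℝ η s x (X x) v +
      ∑ i, η x (Function.update v i (fderivWithin ℝ X s x (v i))) := by
  simp only [lieDerivWithin, ContinuousAlternatingMap.add_apply,
    ContinuousAlternatingMap.fderivCompContinuousLinearMap_apply]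
  congr 1
  refine Finset.sum_congr rfl fun i _ => congrArg _ (funext fun j => ?_)
  rcases eq_or_ne j i with rfl | h
  · simp
  · simp [h]

/-- The coordinate formula defining `lieDerivWithin` is the derivative at `t = 0` of the pullback
`φ_t^* η` for every local flow `φ` of `X` (only `φ_0 = id` and `∂_t φ_t = X` at `t = 0` matter). -/
theorem hasDerivAt_pullback_flow {k : ℕ} {X : E → E} {η : E → E [⋀^Fin k]→L[ℝ] ℝ} {x : E}
    {φ : ℝ × E → E} (hφ : ContDiffAt ℝ 2 φ (0, x)) (h0 : ∀ᶠ y in 𝓝 x, φ (0, y) = y)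
    (hX : ∀ᶠ y in 𝓝 x, HasDerivAt (fun t => φ (t, y)) (X y) 0) (hη : DifferentiableAt ℝ η x) :
    HasDerivAt (fun t => (η (φ (t, x))).compContinuousLinearMap (fderiv ℝ (fun y => φ (t, y)) x))
      (lieDerivWithin X η univ x) 0 := by
  have hd : ∀ᶠ p in 𝓝 ((0 : ℝ), x), DifferentiableAt ℝ φ p :=
    (hφ.eventually (by simp)).mono fun p hp => hp.differentiableAt (by simp)
  have hd' : ∀ᶠ t in 𝓝 (0 : ℝ), DifferentiableAt ℝ φ (t, x) :=
    (show Tendsto (fun t : ℝ => (t, x)) (𝓝 0) (𝓝 (0, x)) from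
      (Continuous.prodMk_left x).tendsto 0).eventually hd
  have hdy : ∀ᶠ y in 𝓝 x, DifferentiableAt ℝ φ (0, y) :=
    (show Tendsto (fun y : E => ((0 : ℝ), y)) (𝓝 x) (𝓝 (0, x)) from
      (Continuous.prodMk_right (0 : ℝ)).tendsto x).eventually hd
  have hdd : DifferentiableAt ℝ (fderiv ℝ φ) (0, x) :=
    (hφ.fderiv_right (m := 1) (by norm_num)).differentiableAt (by simp)
  have hsymm : IsSymmSndFDerivAt ℝ φ (0, x) := hφ.isSymmSndFDerivAt (by simp)
  have hleft : HasDerivAt (fun t : ℝ => (t, x)) ((1 : ℝ), (0 : E)) 0 :=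
    (hasDerivAt_id (0 : ℝ)).prodMk (hasDerivAt_const (0 : ℝ) x)
  have hright : ∀ y : E, HasFDerivAt (fun y : E => ((0 : ℝ), y))
      (ContinuousLinearMap.inr ℝ ℝ E) y := fun y => hasFDerivAt_prodMk_right (0 : ℝ) y
  -- the velocity, as a partial derivative
  have hX' : ∀ᶠ y in 𝓝 x, X y = fderiv ℝ φ (0, y) (1, 0) := by
    filter_upwards [hX, hdy] with y h1 h2
    exact h1.unique (h2.hasFDerivAt.comp_hasDerivAt (0 : ℝ)
      ((hasDerivAt_id (0 : ℝ)).prodMk (hasDerivAt_const (0 : ℝ) y)))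
  have hXx : HasFDerivAt X ((((ContinuousLinearMap.apply ℝ E ((1 : ℝ), (0 : E))).comp
      (fderiv ℝ (fderiv ℝ φ) (0, x))).comp (ContinuousLinearMap.inr ℝ ℝ E))) x := by
    refine HasFDerivAt.congr_of_eventuallyEq ?_ hX'
    exact ((ContinuousLinearMap.apply ℝ E ((1 : ℝ), (0 : E))).hasFDerivAt.comp (0, x)
      hdd.hasFDerivAt).comp x (hright x)
  -- the spatial derivative of the flow
  have hg : HasDerivAt (fun t => fderiv ℝ (fun y => φ (t, y)) x) (fderiv ℝ X x) 0 := by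
    have h1 : HasDerivAt (fun t => (fderiv ℝ φ (t, x)).comp (ContinuousLinearMap.inr ℝ ℝ E))
        ((fderiv ℝ (fderiv ℝ φ) (0, x) (1, 0)).comp (ContinuousLinearMap.inr ℝ ℝ E)) 0 :=
      ((ContinuousLinearMap.compL ℝ E (ℝ × E) E).flip
        (ContinuousLinearMap.inr ℝ ℝ E)).hasFDerivAt.comp_hasDerivAt (0 : ℝ)
        (hdd.hasFDerivAt.comp_hasDerivAt (0 : ℝ) hleft)
    have h2 : fderiv ℝ X x =
        (fderiv ℝ (fderiv ℝ φ) (0, x) (1, 0)).comp (ContinuousLinearMap.inr ℝ ℝ E) := by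
      rw [hXx.fderiv]
      ext v
      exact hsymm _ _
    rw [h2]
    refine h1.congr_of_eventuallyEq ?_
    filter_upwards [hd'] with t ht
    exact (ht.hasFDerivAt.comp x (hasFDerivAt_prodMk_right t x)).fderiv
  have hφ0 : φ (0, x) = x := h0.self_of_nhds
  have hf : HasDerivAt (fun t => η (φ (t, x))) (fderiv ℝ η x (X x)) 0 := by
    refine HasFDerivAt.comp_hasDerivAt (0 : ℝ) ?_ hX.self_of_nhds
    rw [hφ0]
    exact hη.hasFDerivAt
  have hid : fderiv ℝ (fun y => φ (0, y)) x = ContinuousLinearMap.id ℝ E := by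
    rw [Filter.EventuallyEq.fderiv_eq (show (fun y => φ (0, y)) =ᶠ[𝓝 x] id from h0), fderiv_id]
  have := (hf.hasFDerivAt.continuousAlternatingMapCompContinuousLinearMap hg.hasFDerivAt).hasDerivAt
  convert this using 1
  simp only [lieDerivWithin, fderivWithin_univ, hid, hφ0]
  ext v
  simp

end NormedSpace

section Manifold

variable {E : Type*} [NormedAddCommGroup E] [NormedSpace ℝ E]
  {H : Type*} [TopologicalSpace H] (I : ModelWithCorners ℝ E H)
  (M : Type*) [TopologicalSpace M] [ChartedSpace H M]

/-- Vector fields on `M` (not necessarily smooth). -/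
abbrev VecField : Type _ := ∀ x : M, TangentSpace I x

/-- Differential `k`-forms on `M` (not necessarily smooth). -/
abbrev Form (k : ℕ) : Type _ := ∀ x : M, TangentSpace I x [⋀^Fin k]→L[ℝ] ℝ

variable {I M} {k : ℕ}

/-- Smoothness of a vector field, as a section of the tangent bundle. -/
def VecField.IsSmooth [IsManifold I 1 M] (X : VecField I M) : Prop :=
  ContMDiff I I.tangent ∞ (fun x => (⟨x, X x⟩ : TangentBundle I M))

/-- The expression of the form `η` in the chart at `x₀`, i.e. its pullback by the inverse of that
chart. -/
def Form.inChart (η : Form I M k) (x₀ : M) (y : E) : E [⋀^Fin k]→L[ℝ] ℝ :=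
  (η ((extChartAt I x₀).symm y)).compContinuousLinearMap
    (mfderivWithin 𝓘(ℝ, E) I (extChartAt I x₀).symm (range I) y)

/-- A form is smooth if its expressions in the charts are smooth. -/
def Form.IsSmooth (η : Form I M k) : Prop :=
  ∀ x₀ : M, ContDiffOn ℝ ∞ (η.inChart x₀) (extChartAt I x₀).target

/-- The exterior derivative, computed in the chart at the base point. -/
def extDer (η : Form I M k) : Form I M (k + 1) := fun x =>
  (extDerivWithin (η.inChart x) (range I) (extChartAt I x x)).compContinuousLinearMap
    (mfderiv I 𝓘(ℝ, E) (extChartAt I x) x)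

/-- The Lie derivative `L_X η`, computed in the chart at the base point. -/
def lieDeriv (X : VecField I M) (η : Form I M k) : Form I M k := fun x =>
  (lieDerivWithin
    (VectorField.mpullbackWithin 𝓘(ℝ, E) I (extChartAt I x).symm X (range I))
    (η.inChart x) (range I) (extChartAt I x x)).compContinuousLinearMap
    (mfderiv I 𝓘(ℝ, E) (extChartAt I x) x)

/-- The interior product `i_X η = η(X, ·, …, ·)`. -/
def interiorProduct (X : VecField I M) (η : Form I M (k + 1)) : Form I M k := fun x =>
  ContinuousAlternatingMap.curryLeft (E := E) (η x) (X x)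

/-- The pullback `f^* η` of a form by a map. -/
def formPullback (f : M → M) (η : Form I M k) : Form I M k := fun x =>
  (η (f x)).compContinuousLinearMap (mfderiv I I f x)

/-- A volume form on an `n`-manifold: a smooth, nowhere vanishing form (of top degree `n`). -/
def IsVolumeForm {n : ℕ} [ChartedSpace (EuclideanSpace ℝ (Fin n)) M] (Ω : Form (𝓡 n) M n) : Prop :=
  Ω.IsSmooth ∧ ∀ x, Ω x ≠ 0

/-- `X` is exact incompressible for the volume form `Ω`: `X` is smooth and `i_X Ω` is exact. -/
def IsExactIncompressible [IsManifold I 1 M] (Ω : Form I M (k + 2)) (X : VecField I M) : Prop :=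
  X.IsSmooth ∧ ∃ γ : Form I M k, γ.IsSmooth ∧ interiorProduct X Ω = extDer γ

/-- `β` is a structure form of `X` with respect to `α`: `β` is smooth and `L_X α = dβ`. -/
def IsStructureForm (α : Form I M (k + 1)) (X : VecField I M) (β : Form I M k) : Prop :=
  β.IsSmooth ∧ lieDeriv X α = extDer β

/-- `f^* α - α = dλ` with a smooth form `λ` (written `l`), so that the diffeomorphism `f` is exact
volume preserving with respect to `α`. -/
def IsExactVolumePreserving (α : Form I M (k + 1)) (f : M ≃ₘ^∞⟮I, I⟯ M) (l : Form I M k) : Prop :=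
  l.IsSmooth ∧ formPullback f α - α = extDer l

end Manifold

end ExactVol

end

open ExactVol

/-! Everything follows from three identities: `L_X d = d L_X`, `L_[X,Y] = L_X L_Y - L_Y L_X` and
`L_{f^*Z} f^*η = f^* L_Z η`. For the bracket, `L_[X,Y] α = L_X dβ_Y - L_Y dβ_X = d(L_X β_Y - L_Y
β_X)`. For the pull-back, write `α = f^*α - dλ`; then `L_{f^*Z} α = f^* L_Z α - d L_{f^*Z} λ =
d(f^*β_Z - L_{f^*Z} λ)`. Exact incompressibility comes with the structure form: Cartan's formula
gives `i_X dα = L_X α - d i_X α = d(β - i_X α)`.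

On a normed space the identities are obtained by differentiating the coordinate formula of the Lie
derivative and using symmetry of second derivatives (`lieDerivWithin_univ_eq`,
`lieDerivWithin_lieBracket`, `lieDerivWithin_pullback`). On `M`, `extDer` and `lieDeriv` use a chart
that varies with the point. Naturality under transition maps shows that one fixed chart computes
them on its whole target (`extDer_inChart`, `lieDeriv_inChart`), so these operators can be iterated
and the flat identities transfer. -/

noncomputable section

namespace ExactVol

/-! ### Exterior and Lie derivatives on a normed space -/

section NormedSpace

variable {E F : Type*} [NormedAddCommGroup E] [NormedSpace ℝ E]
  [NormedAddCommGroup F] [NormedSpace ℝ F]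

open ContinuousAlternatingMap

/-- A continuous linear left inverse of the inclusion of alternating maps into multilinear maps:
the normalized alternatization. -/
theorem exists_leftInverse_toContinuousMultilinearMapCLM (k : ℕ) :
    ∃ L : ContinuousMultilinearMap ℝ (fun _ : Fin k => E) ℝ →L[ℝ] E [⋀^Fin k]→L[ℝ] ℝ,
      ∀ η : E [⋀^Fin k]→L[ℝ] ℝ, L η.toContinuousMultilinearMap = η := by
  let A : ContinuousMultilinearMap ℝ (fun _ : Fin k => E) ℝ →ₗ[ℝ] E [⋀^Fin k]→L[ℝ] ℝ :=
    { toFun := fun m => ContinuousMultilinearMap.alternatization m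
      map_add' := fun m m' => map_add _ m m'
      map_smul' := fun c m => by
        ext v
        simp [ContinuousMultilinearMap.alternatization_apply_apply, Finset.mul_sum,
          mul_smul_comm] }
  have hA : ∀ m v, A m v = ∑ σ : Equiv.Perm (Fin k), Equiv.Perm.sign σ • m (v ∘ σ) := fun m v =>
    ContinuousMultilinearMap.alternatization_apply_apply _ _
  let B : ContinuousMultilinearMap ℝ (fun _ : Fin k => E) ℝ →L[ℝ] E [⋀^Fin k]→L[ℝ] ℝ :=
    A.mkContinuous (Fintype.card (Equiv.Perm (Fin k))) fun m => by
      refine ContinuousAlternatingMap.opNorm_le_bound _ (by positivity) fun v => ?_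
      rw [hA]
      refine (norm_sum_le _ _).trans ?_
      rw [mul_assoc, ← nsmul_eq_mul]
      refine Finset.sum_le_card_nsmul _ _ _ fun σ _ => ?_
      have h : ‖Equiv.Perm.sign σ • m (v ∘ σ)‖ = ‖m (v ∘ σ)‖ := by
        rcases Int.units_eq_one_or (Equiv.Perm.sign σ) with h | h <;> simp [h]
      rw [h, ← Equiv.prod_comp σ fun i => ‖v i‖]
      exact m.le_opNorm _
  -- On an alternating map all `k!` signed permutation terms coincide, so alternatization multiplies
  -- it by `k!`.
  refine ⟨((k.factorial : ℝ)⁻¹) • B, fun η => ?_⟩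
  ext v
  have h : ∀ σ : Equiv.Perm (Fin k),
      Equiv.Perm.sign σ • η.toContinuousMultilinearMap (v ∘ σ) = η v := fun σ => by
    have := η.toAlternatingMap.map_perm v σ
    change _ • η.toAlternatingMap (v ∘ σ) = _
    rw [this, smul_smul, Int.units_mul_self, one_smul]
    rfl
  have hB : B η.toContinuousMultilinearMap v = k.factorial • η v := by
    change A _ v = _
    rw [hA, Finset.sum_congr rfl fun σ _ => h σ]
    simp [Fintype.card_perm]
  have h0 : (k.factorial : ℝ) ≠ 0 := by exact_mod_cast k.factorial_ne_zero
  simp [hB, h0]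

/-- The pullback of alternating maps is jointly smooth. -/
theorem contDiff_compContinuousLinearMap (k : ℕ) {n : ℕ∞ω} :
    ContDiff ℝ n (fun p : (F [⋀^Fin k]→L[ℝ] ℝ) × (E →L[ℝ] F) =>
      p.1.compContinuousLinearMap p.2) := by
  -- Pullback of multilinear maps is multilinear in the linear maps, hence smooth; `L` carries this
  -- smoothness back to alternating maps.
  obtain ⟨L, hL⟩ := exists_leftInverse_toContinuousMultilinearMapCLM (E := E) k
  have h : (fun p : (F [⋀^Fin k]→L[ℝ] ℝ) × (E →L[ℝ] F) => p.1.compContinuousLinearMap p.2) =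
      fun p => L (ContinuousMultilinearMap.compContinuousLinearMapContinuousMultilinear ℝ
        (fun _ : Fin k => E) (fun _ => F) ℝ (fun _ => p.2) (toContinuousMultilinearMapCLM ℝ p.1)) := by
    funext p
    exact (hL _).symm
  rw [h]
  refine L.contDiff.comp (ContDiff.clm_apply ?_ ?_)
  · exact (ContinuousMultilinearMap.contDiff _).comp (contDiff_pi.2 fun _ => contDiff_snd)
  · exact (toContinuousMultilinearMapLI (𝕜 := ℝ) (E := F) (F := ℝ) (ι := Fin k)).contDiff.comp
      contDiff_fst

theorem contDiffAt_pullback {k : ℕ} {n : ℕ∞ω} {η : F → F [⋀^Fin k]→L[ℝ] ℝ} {f : E → F} {x : E}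
    (hη : ContDiffAt ℝ n η (f x)) (hf : ContDiffAt ℝ n f x) (hf' : ContDiffAt ℝ n (fderiv ℝ f) x) :
    ContDiffAt ℝ n (fun y => (η (f y)).compContinuousLinearMap (fderiv ℝ f y)) x :=
  (contDiff_compContinuousLinearMap k).contDiffAt.comp x ((hη.comp x hf).prodMk hf')

theorem contDiffAt_infty_fderiv {G : Type*} [NormedAddCommGroup G] [NormedSpace ℝ G]
    {f : E → G} {x : E} (hf : ContDiffAt ℝ ∞ f x) : ContDiffAt ℝ ∞ (fderiv ℝ f) x :=
  hf.fderiv_right (by simp)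

theorem contDiffAt_extDeriv {k : ℕ} {η : E → E [⋀^Fin k]→L[ℝ] ℝ} {x : E}
    (hη : ContDiffAt ℝ ∞ η x) : ContDiffAt ℝ ∞ (extDeriv η) x := by
  have h := (contDiffAt_infty_fderiv hη).continuousLinearMap_comp
    (F := E →L[ℝ] E [⋀^Fin k]→L[ℝ] ℝ) (G := E [⋀^Fin (k + 1)]→L[ℝ] ℝ)
    (alternatizeUncurryFinCLM ℝ E ℝ)
  exact h

theorem contDiffAt_lieDerivWithin {k : ℕ} {X : E → E} {η : E → E [⋀^Fin k]→L[ℝ] ℝ} {x : E}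
    (hX : ContDiffAt ℝ ∞ X x) (hη : ContDiffAt ℝ ∞ η x) :
    ContDiffAt ℝ ∞ (lieDerivWithin X η univ) x := by
  have h : lieDerivWithin X η univ = fun y => fderiv ℝ η y (X y) +
      fderivCompContinuousLinearMapCLM ℝ (ContinuousLinearMap.id ℝ E) (η y) (fderiv ℝ X y) := by
    funext y
    simp [lieDerivWithin]
  rw [h]
  have h1 : ContDiffAt ℝ ∞
      (fun y => fderivCompContinuousLinearMapCLM ℝ (ContinuousLinearMap.id ℝ E) (η y)) x := by
    have h := hη.continuousLinearMap_comp (F := E [⋀^Fin k]→L[ℝ] ℝ)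
      (G := (E →L[ℝ] E) →L[ℝ] E [⋀^Fin k]→L[ℝ] ℝ)
      (fderivCompContinuousLinearMapCLM ℝ (ContinuousLinearMap.id ℝ E))
    exact h
  exact ((contDiffAt_infty_fderiv hη).clm_apply hX).add
    (h1.clm_apply (contDiffAt_infty_fderiv hX))

theorem contDiffAt_curryLeft {k : ℕ} {n : ℕ∞ω} {X : E → E} {η : E → E [⋀^Fin (k + 1)]→L[ℝ] ℝ}
    {x : E} (hX : ContDiffAt ℝ n X x) (hη : ContDiffAt ℝ n η x) :
    ContDiffAt ℝ n (fun y => (η y).curryLeft (X y)) x := by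
  have h : ContDiffAt ℝ n (fun y => (η y).curryLeft) x := by
    have h := hη.continuousLinearMap_comp (F := E [⋀^Fin (k + 1)]→L[ℝ] ℝ)
      (G := E →L[ℝ] E [⋀^Fin k]→L[ℝ] ℝ) curryLeftLI.toContinuousLinearMap
    exact h
  exact h.clm_apply hX

/-- Cartan's formula on a normed space. -/
theorem lieDerivWithin_univ_eq {k : ℕ} {X : E → E} {η : E → E [⋀^Fin (k + 1)]→L[ℝ] ℝ} {x : E}
    (hX : DifferentiableAt ℝ X x) (hη : DifferentiableAt ℝ η x) :
    lieDerivWithin X η univ x =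
      (extDeriv η x).curryLeft (X x) + extDeriv (fun y => (η y).curryLeft (X y)) x := by
  have hc : HasFDerivAt (fun y => (η y).curryLeft) ((curryLeftLI (𝕜 := ℝ) (E := E) (F := ℝ)
      (n := k)).toContinuousLinearMap.comp (fderiv ℝ η x)) x := by
    have h := HasFDerivAt.comp (E := E) (F := E [⋀^Fin (k + 1)]→L[ℝ] ℝ)
      (G := E →L[ℝ] E [⋀^Fin k]→L[ℝ] ℝ) x
      (curryLeftLI.toContinuousLinearMap.hasFDerivAt (x := η x)) hη.hasFDerivAt
    exact h
  have hd := hc.clm_apply hX.hasFDerivAt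
  have h1 : (η x).fderivCompContinuousLinearMap (ContinuousLinearMap.id ℝ E) (fderiv ℝ X x) =
      alternatizeUncurryFin (((η x).curryLeft).comp (fderiv ℝ X x)) := by
    rw [fderivCompContinuousLinearMap_eq_alternatizeUncurryFin]
    rfl
  simp only [lieDerivWithin, fderivWithin_univ, extDeriv, hd.fderiv, alternatizeUncurryFin_add, h1]
  ext v
  have h2 : ∀ i : Fin (k + 1), i.succ.removeNth (Matrix.vecCons (X x) v) =
      Matrix.vecCons (X x) (i.removeNth v) := fun i => by
    funext j
    refine Fin.cases ?_ (fun j => ?_) j <;> simp [Fin.removeNth]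
  have h3 : (0 : Fin (k + 2)).removeNth (Matrix.vecCons (X x) v) = v := by
    funext j
    simp [Fin.removeNth]
  simp only [ContinuousAlternatingMap.add_apply, curryLeft_apply_apply, alternatizeUncurryFin_apply]
  -- In `i_X dη` the term of index `0` is `Dη(X)`. The terms of index `i.succ` carry the opposite
  -- sign to those of `d(i_X η)` that differentiate `η`, and cancel them.
  rw [Fin.sum_univ_succ (n := k + 1), h3]
  simp_rw [h2]
  simp [pow_succ]
  abel

/-- In degree zero the Lie derivative is the contraction of the exterior derivative. -/
theorem lieDerivWithin_univ_eq_zero_form {X : E → E} {η : E → E [⋀^Fin 0]→L[ℝ] ℝ} {x : E} :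
    lieDerivWithin X η univ x = (extDeriv η x).curryLeft (X x) := by
  ext v
  simp [lieDerivWithin, extDeriv, alternatizeUncurryFin_apply, Subsingleton.elim _ v]

/-- The `Function.update` form makes `map_update_add` and `map_update_sub` applicable. -/
theorem fderivCompContinuousLinearMap_apply_update {k : ℕ} (η : F [⋀^Fin k]→L[ℝ] ℝ)
    (g dg : E →L[ℝ] F) (v : Fin k → E) :
    η.fderivCompContinuousLinearMap g dg v =
      ∑ i, η (Function.update (fun j => g (v j)) i (dg (v i))) := by
  rw [fderivCompContinuousLinearMap_apply]
  refine Finset.sum_congr rfl fun i _ => congrArg _ (funext fun j => ?_)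
  rcases eq_or_ne j i with rfl | h
  · simp
  · simp [h]

/-- Insertions of `S` and `T` into different slots commute and cancel; only the diagonal terms
survive. The action is by precomposition, which reverses the order: `T` followed by `S` on forms
puts `T (S vᵢ)` in the slot. -/
theorem fderivComp_commutator {k : ℕ} (η : E [⋀^Fin k]→L[ℝ] ℝ) (S T : E →L[ℝ] E) :
    (η.fderivCompContinuousLinearMap (.id ℝ E) T).fderivCompContinuousLinearMap (.id ℝ E) S -
      (η.fderivCompContinuousLinearMap (.id ℝ E) S).fderivCompContinuousLinearMap (.id ℝ E) T =
    η.fderivCompContinuousLinearMap (.id ℝ E) (T.comp S - S.comp T) := by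
  ext v
  have key : ∀ i j, η (Function.update (Function.update v i (S (v i))) j
      (T (Function.update v i (S (v i)) j))) - η (Function.update (Function.update v j (T (v j))) i
      (S (Function.update v j (T (v j)) i))) =
      if i = j then η (Function.update v i (T (S (v i)) - S (T (v i)))) else 0 := by
    intro i j
    split_ifs with h
    · subst h
      simp [η.map_update_sub]
    · rw [Function.update_of_ne (Ne.symm h), Function.update_of_ne h, Function.update_comm h,
        sub_self]
  simp only [ContinuousAlternatingMap.sub_apply, fderivCompContinuousLinearMap_apply_update,
    ContinuousLinearMap.id_apply, _root_.sub_apply, ContinuousLinearMap.comp_apply]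
  rw [Finset.sum_comm (s := Finset.univ) (t := Finset.univ) (f := fun i j =>
    η (Function.update (Function.update v i (T (v i))) j (S (Function.update v i (T (v i)) j)))),
    ← Finset.sum_sub_distrib]
  refine Finset.sum_congr rfl fun i _ => ?_
  rw [← Finset.sum_sub_distrib, Finset.sum_congr rfl fun j _ => key i j]
  simp

theorem fderiv_lieDerivWithin {k : ℕ} {Y : E → E} {η : E → E [⋀^Fin k]→L[ℝ] ℝ} {x : E}
    (hY : ContDiffAt ℝ 2 Y x) (hη : ContDiffAt ℝ 2 η x) (u : E) :
    fderiv ℝ (lieDerivWithin Y η univ) x u =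
      fderiv ℝ (fderiv ℝ η) x u (Y x) + fderiv ℝ η x (fderiv ℝ Y x u) +
      ((fderiv ℝ η x u).fderivCompContinuousLinearMap (.id ℝ E) (fderiv ℝ Y x) +
      (η x).fderivCompContinuousLinearMap (.id ℝ E) (fderiv ℝ (fderiv ℝ Y) x u)) := by
  have h : lieDerivWithin Y η univ = fun y => fderiv ℝ η y (Y y) +
      fderivCompContinuousLinearMapCLM ℝ (ContinuousLinearMap.id ℝ E) (η y) (fderiv ℝ Y y) := by
    funext y
    simp [lieDerivWithin]
  have hη1 := (hη.differentiableAt (by simp)).hasFDerivAt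
  have hY1 := (hY.differentiableAt (by simp)).hasFDerivAt
  have hη2 := ((hη.fderiv_right (m := 1) (by norm_num)).differentiableAt (by simp)).hasFDerivAt
  have hY2 := ((hY.fderiv_right (m := 1) (by norm_num)).differentiableAt (by simp)).hasFDerivAt
  have h1 : HasFDerivAt
      (fun y => fderivCompContinuousLinearMapCLM ℝ (ContinuousLinearMap.id ℝ E) (η y))
      ((fderivCompContinuousLinearMapCLM ℝ (ContinuousLinearMap.id ℝ E)).comp (fderiv ℝ η x)) x := by
    have h := HasFDerivAt.comp (E := E) (F := E [⋀^Fin k]→L[ℝ] ℝ)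
      (G := (E →L[ℝ] E) →L[ℝ] E [⋀^Fin k]→L[ℝ] ℝ) x
      ((fderivCompContinuousLinearMapCLM ℝ (ContinuousLinearMap.id ℝ E)).hasFDerivAt (x := η x)) hη1
    exact h
  rw [h, HasFDerivAt.fderiv ((hη2.clm_apply hY1).fun_add (h1.clm_apply hY2))]
  simp
  abel

/-- After expansion by the product rule, the `D²η` terms cancel by symmetry, and the terms pairing
`Dη` along one field with the derivative of the other are symmetric in `X` and `Y`. What remains is
`Dη([X,Y])` and the action of `D[X,Y]` on `η`, whose first-order part is the commutator of `DX` and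
`DY`. -/
theorem lieDerivWithin_lieBracket {k : ℕ} {X Y : E → E} {η : E → E [⋀^Fin k]→L[ℝ] ℝ} {x : E}
    (hX : ContDiffAt ℝ 2 X x) (hY : ContDiffAt ℝ 2 Y x) (hη : ContDiffAt ℝ 2 η x) :
    lieDerivWithin (VectorField.lieBracket ℝ X Y) η univ x =
      lieDerivWithin X (lieDerivWithin Y η univ) univ x -
        lieDerivWithin Y (lieDerivWithin X η univ) univ x := by
  have hη2 : fderiv ℝ (fderiv ℝ η) x (X x) (Y x) = fderiv ℝ (fderiv ℝ η) x (Y x) (X x) :=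
    (hη.isSymmSndFDerivAt (by simp)) _ _
  have hX1 := (hX.differentiableAt (by simp)).hasFDerivAt
  have hY1 := (hY.differentiableAt (by simp)).hasFDerivAt
  have hX2 := ((hX.fderiv_right (m := 1) (by norm_num)).differentiableAt (by simp)).hasFDerivAt
  have hY2 := ((hY.fderiv_right (m := 1) (by norm_num)).differentiableAt (by simp)).hasFDerivAt
  have hb : fderiv ℝ (VectorField.lieBracket ℝ X Y) x =
      fderiv ℝ (fderiv ℝ Y) x (X x) - fderiv ℝ (fderiv ℝ X) x (Y x) +
        ((fderiv ℝ Y x).comp (fderiv ℝ X x) - (fderiv ℝ X x).comp (fderiv ℝ Y x)) := by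
    have := (hY2.clm_apply hX1).fun_sub (hX2.clm_apply hY1)
    rw [show VectorField.lieBracket ℝ X Y = _ from VectorField.lieBracket_eq, HasFDerivAt.fderiv this]
    ext v
    have e1 : fderiv ℝ (fderiv ℝ Y) x (X x) v = fderiv ℝ (fderiv ℝ Y) x v (X x) :=
      (hY.isSymmSndFDerivAt (by simp)) _ _
    have e2 : fderiv ℝ (fderiv ℝ X) x (Y x) v = fderiv ℝ (fderiv ℝ X) x v (Y x) :=
      (hX.isSymmSndFDerivAt (by simp)) _ _
    simp [e1, e2]
    abel
  have hc := fderivComp_commutator (η x) (fderiv ℝ X x) (fderiv ℝ Y x)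
  rw [lieDerivWithin, fderivWithin_univ, fderivWithin_univ, hb, map_add, ← hc,
    lieDerivWithin.eq_1 X (lieDerivWithin Y η univ), lieDerivWithin.eq_1 Y (lieDerivWithin X η univ),
    fderivWithin_univ, fderivWithin_univ, fderivWithin_univ, fderivWithin_univ,
    fderiv_lieDerivWithin hX hη, fderiv_lieDerivWithin hY hη, hη2, VectorField.lieBracket]
  simp only [lieDerivWithin, fderivWithin_univ, map_sub,
    ← fderivCompContinuousLinearMapCLM_apply, map_add, _root_.add_apply]
  abel

/-- The Lie derivative is natural under pullback. -/
theorem lieDerivWithin_pullback {k : ℕ} {X V : E → E} {η : E → E [⋀^Fin k]→L[ℝ] ℝ} {f : E → E}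
    {x : E} (hη : DifferentiableAt ℝ η (f x)) (hX : DifferentiableAt ℝ X (f x))
    (hf : ContDiffAt ℝ 2 f x) (hV : DifferentiableAt ℝ V x)
    (hVX : ∀ᶠ y in 𝓝 x, fderiv ℝ f y (V y) = X (f y)) :
    lieDerivWithin V (fun y => (η (f y)).compContinuousLinearMap (fderiv ℝ f y)) univ x =
      (lieDerivWithin X η univ (f x)).compContinuousLinearMap (fderiv ℝ f x) := by
  have hf1 := (hf.differentiableAt (by simp)).hasFDerivAt
  have hf2 := ((hf.fderiv_right (m := 1) (by norm_num)).differentiableAt (by simp)).hasFDerivAt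
  have hd := ((hη.hasFDerivAt.comp x hf1).continuousAlternatingMapCompContinuousLinearMap hf2).fderiv
  -- Differentiating the relation `Df · V = X ∘ f` in the direction `v` absorbs the `D²f` term
  -- produced by differentiating the pullback.
  have hVX' : ∀ v, fderiv ℝ (fderiv ℝ f) x (V x) v + fderiv ℝ f x (fderiv ℝ V x v) =
      fderiv ℝ X (f x) (fderiv ℝ f x v) := fun v => by
    have h := ((hf2.clm_apply hV.hasFDerivAt).congr_of_eventuallyEq
      (hVX.mono fun y hy => hy.symm)).unique (hX.hasFDerivAt.comp x hf1)
    have h' := congrArg (fun L => L v) h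
    have e1 : fderiv ℝ (fderiv ℝ f) x (V x) v = fderiv ℝ (fderiv ℝ f) x v (V x) :=
      (hf.isSymmSndFDerivAt (by simp)) _ _
    simp at h'
    rw [e1, add_comm, h']
  simp only [lieDerivWithin, fderivWithin_univ]
  rw [show fderiv ℝ (fun y => (η (f y)).compContinuousLinearMap (fderiv ℝ f y)) x = _ from hd]
  ext v
  simp only [ContinuousAlternatingMap.add_apply, _root_.add_apply,
    ContinuousLinearMap.comp_apply, compContinuousLinearMapCLM_apply,
    compContinuousLinearMap_apply, fderivCompContinuousLinearMap_apply_update,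
    ContinuousLinearMap.id_apply, hVX.self_of_nhds, ← hVX', (η (f x)).map_update_add,
    Finset.sum_add_distrib, Function.comp_def, Function.apply_update (fun _ => fderiv ℝ f x)]
  rw [add_assoc]

end NormedSpace

/-! ### Forms, vector fields and maps read in charts -/

section Charts

variable {E : Type*} [NormedAddCommGroup E] [NormedSpace ℝ E]
  {H : Type*} [TopologicalSpace H] {I : ModelWithCorners ℝ E H}
  {M : Type*} [TopologicalSpace M] [ChartedSpace H M] {k : ℕ}

variable (I) in
/-- The derivative of the inverse of the chart at `x₀`, as an endomorphism of the model space. -/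
def symmDeriv (x₀ : M) (y : E) : E →L[ℝ] E :=
  mfderivWithin 𝓘(ℝ, E) I (extChartAt I x₀).symm (range I) y

variable (I) in
/-- The derivative of the chart at `x₀`, as an endomorphism of the model space. -/
def chartDeriv (x₀ x : M) : E →L[ℝ] E :=
  mfderiv I 𝓘(ℝ, E) (extChartAt I x₀) x

variable (I) in
/-- The derivative of `f : M → M`, as an endomorphism of the model space. -/
def mapDeriv (f : M → M) (x : M) : E →L[ℝ] E :=
  mfderiv I I f x

/-- The expression of a vector field in the chart at `x₀`. -/
def VecField.inChart (X : VecField I M) (x₀ : M) : E → E :=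
  VectorField.mpullbackWithin 𝓘(ℝ, E) I (extChartAt I x₀).symm X (range I)

variable (I) in
/-- The expression of `f` in the charts at `x₀` and `x₁`. -/
def chartMap (f : M → M) (x₀ x₁ : M) : E → E :=
  extChartAt I x₁ ∘ f ∘ (extChartAt I x₀).symm

/-- A form as a function with values in a fixed space. -/
def Form.toFun (η : Form I M k) (x : M) : E [⋀^Fin k]→L[ℝ] ℝ := η x

/-- A vector field as a function with values in a fixed space. -/
def VecField.toFun (X : VecField I M) (x : M) : E := X x

/-- Tangent spaces unfold to `E`; with all values in fixed spaces, base points can be rewritten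
without dependent types. -/
theorem Form.inChart_eq (η : Form I M k) (x₀ : M) (y : E) :
    η.inChart x₀ y =
      (η.toFun ((extChartAt I x₀).symm y)).compContinuousLinearMap (symmDeriv I x₀ y) := rfl

theorem VecField.inChart_eq (X : VecField I M) (x₀ : M) (y : E) :
    X.inChart x₀ y = (symmDeriv I x₀ y).inverse (X.toFun ((extChartAt I x₀).symm y)) := rfl

section

variable [IsManifold I 1 M] {x₀ x₁ x : M} {y : E}

theorem isInvertible_symmDeriv (hy : y ∈ (extChartAt I x₀).target) :
    (symmDeriv I x₀ y).IsInvertible :=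
  isInvertible_mfderivWithin_extChartAt_symm hy

theorem chartDeriv_comp_symmDeriv (hy : y ∈ (extChartAt I x₀).target) :
    (chartDeriv I x₀ ((extChartAt I x₀).symm y)).comp (symmDeriv I x₀ y) = .id ℝ E :=
  mfderiv_extChartAt_comp_mfderivWithin_extChartAt_symm hy

theorem symmDeriv_comp_chartDeriv (hx : x ∈ (extChartAt I x₀).source) :
    (symmDeriv I x₀ (extChartAt I x₀ x)).comp (chartDeriv I x₀ x) = .id ℝ E :=
  mfderivWithin_extChartAt_symm_comp_mfderiv_extChartAt' hx

theorem Form.toFun_eq_inChart (η : Form I M k) (x : M) :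
    η.toFun x = (η.inChart x (extChartAt I x x)).compContinuousLinearMap (chartDeriv I x x) := by
  have h := symmDeriv_comp_chartDeriv (I := I) (mem_extChartAt_source x)
  rw [Form.inChart_eq, extChartAt_to_inv]
  ext v
  have h' : ∀ w, symmDeriv I x (extChartAt I x x) (chartDeriv I x x w) = w := fun w =>
    congrArg (fun L => L w) h
  change η.toFun x v = η.toFun x fun i =>
    symmDeriv I x (extChartAt I x x) (chartDeriv I x x (v i))
  congr 1
  funext i
  exact (h' _).symm

/-- Each point lies in its own preferred chart, whose derivative there is inverted by that of the
inverse chart. -/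
theorem Form.ext_inChart {η θ : Form I M k}
    (h : ∀ x, η.inChart x (extChartAt I x x) = θ.inChart x (extChartAt I x x)) : η = θ := by
  funext x
  change η.toFun x = θ.toFun x
  rw [Form.toFun_eq_inChart, Form.toFun_eq_inChart, h]

theorem symmDeriv_inChart (X : VecField I M) (hy : y ∈ (extChartAt I x₀).target) :
    symmDeriv I x₀ y (X.inChart x₀ y) = X.toFun ((extChartAt I x₀).symm y) := by
  rw [VecField.inChart_eq]
  exact (isInvertible_symmDeriv hy).self_apply_inverse _

theorem fderiv_chartMap [I.Boundaryless] {f : M → M}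
    (hf : MDifferentiableAt I I f ((extChartAt I x₀).symm y))
    (hy : y ∈ (extChartAt I x₀).target)
    (hfy : f ((extChartAt I x₀).symm y) ∈ (extChartAt I x₁).source) :
    fderiv ℝ (chartMap I f x₀ x₁) y =
      ((chartDeriv I x₁ (f ((extChartAt I x₀).symm y))).comp
        (mapDeriv I f ((extChartAt I x₀).symm y))).comp (symmDeriv I x₀ y) := by
  have h0 : MDifferentiableAt 𝓘(ℝ, E) I (extChartAt I x₀).symm y := by
    have := mdifferentiableWithinAt_extChartAt_symm hy
    rwa [I.range_eq_univ, mdifferentiableWithinAt_univ] at this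
  have h1 : MDifferentiableAt I 𝓘(ℝ, E) (extChartAt I x₁) (f ((extChartAt I x₀).symm y)) :=
    mdifferentiableAt_extChartAt (by rwa [extChartAt_source] at hfy)
  rw [← mfderiv_eq_fderiv, chartMap]
  have e := mfderiv_comp (I' := I) y (MDifferentiableAt.comp _ h1 hf) h0
  rw [mfderiv_comp _ h1 hf] at e
  have e' : mfderiv 𝓘(ℝ, E) I (extChartAt I x₀).symm y = symmDeriv I x₀ y := by
    rw [symmDeriv, I.range_eq_univ, mfderivWithin_univ]
  rw [e'] at e
  exact e

/-- The derivatives of the chart at `x₁` and of its inverse cancel. With `f = id` this is the change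
of chart formula. -/
theorem formPullback_inChart [I.Boundaryless] {f : M → M} (η : Form I M k)
    (hf : MDifferentiableAt I I f ((extChartAt I x₀).symm y))
    (hy : y ∈ (extChartAt I x₀).target)
    (hfy : f ((extChartAt I x₀).symm y) ∈ (extChartAt I x₁).source) :
    (formPullback f η).inChart x₀ y = (η.inChart x₁ (chartMap I f x₀ x₁ y)).compContinuousLinearMap
      (fderiv ℝ (chartMap I f x₀ x₁) y) := by
  have h := symmDeriv_comp_chartDeriv (I := I) hfy
  have h' : ∀ w, symmDeriv I x₁ (extChartAt I x₁ (f ((extChartAt I x₀).symm y)))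
      (chartDeriv I x₁ (f ((extChartAt I x₀).symm y)) w) = w := fun w =>
    congrArg (fun L => L w) h
  rw [fderiv_chartMap hf hy hfy, Form.inChart_eq, Form.inChart_eq]
  have e : (extChartAt I x₁).symm (chartMap I f x₀ x₁ y) = f ((extChartAt I x₀).symm y) :=
    (extChartAt I x₁).left_inv hfy
  rw [e]
  ext v
  change η.toFun (f ((extChartAt I x₀).symm y)) _ = η.toFun (f ((extChartAt I x₀).symm y)) _
  congr 1
  funext i
  exact (h' _).symm

/-- Stated as relatedness under `chartMap`, without inverting its derivative, to match the
hypothesis of `lieDerivWithin_pullback`. -/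
theorem mpullback_inChart [I.Boundaryless] {f : M → M} (X : VecField I M)
    (hf : MDifferentiableAt I I f ((extChartAt I x₀).symm y))
    (hfi : (mapDeriv I f ((extChartAt I x₀).symm y)).IsInvertible)
    (hy : y ∈ (extChartAt I x₀).target)
    (hfy : f ((extChartAt I x₀).symm y) ∈ (extChartAt I x₁).source) :
    fderiv ℝ (chartMap I f x₀ x₁) y (VecField.inChart (VectorField.mpullback I I f X) x₀ y) =
      X.inChart x₁ (chartMap I f x₀ x₁ y) := by
  have e : (extChartAt I x₁).symm (chartMap I f x₀ x₁ y) = f ((extChartAt I x₀).symm y) :=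
    (extChartAt I x₁).left_inv hfy
  have ht : chartMap I f x₀ x₁ y ∈ (extChartAt I x₁).target := (extChartAt I x₁).map_source hfy
  rw [fderiv_chartMap hf hy hfy, ContinuousLinearMap.comp_apply, ContinuousLinearMap.comp_apply,
    symmDeriv_inChart _ hy]
  have e2 : mapDeriv I f ((extChartAt I x₀).symm y) (VecField.toFun (VectorField.mpullback I I f X)
      ((extChartAt I x₀).symm y)) = X.toFun (f ((extChartAt I x₀).symm y)) :=
    hfi.self_apply_inverse _
  rw [e2]
  have h1 := symmDeriv_inChart X ht
  have h2 := chartDeriv_comp_symmDeriv (I := I) ht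
  rw [e] at h1 h2
  rw [← h1]
  exact congrArg (fun L : E →L[ℝ] E => L (X.inChart x₁ (chartMap I f x₀ x₁ y))) h2

end

end Charts

theorem minSmoothness_two_le : minSmoothness ℝ 2 ≤ (∞ : ℕ∞ω) := by
  rw [minSmoothness_of_isRCLikeNormedField]
  norm_cast

theorem lieDerivWithin_congr {E : Type*} [NormedAddCommGroup E] [NormedSpace ℝ E] {k : ℕ}
    {X : E → E} {η θ : E → E [⋀^Fin k]→L[ℝ] ℝ} {x : E} (h : η =ᶠ[𝓝 x] θ) :
    lieDerivWithin X η univ x = lieDerivWithin X θ univ x := by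
  simp only [lieDerivWithin, fderivWithin_univ, h.fderiv_eq, h.self_of_nhds]

theorem lieDerivWithin_congr_field {E : Type*} [NormedAddCommGroup E] [NormedSpace ℝ E] {k : ℕ}
    {X Y : E → E} {η : E → E [⋀^Fin k]→L[ℝ] ℝ} {x : E} (h : X =ᶠ[𝓝 x] Y) :
    lieDerivWithin X η univ x = lieDerivWithin Y η univ x := by
  simp only [lieDerivWithin, fderivWithin_univ, h.fderiv_eq, h.self_of_nhds]

theorem lieDerivWithin_sub {E : Type*} [NormedAddCommGroup E] [NormedSpace ℝ E] {k : ℕ}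
    {X : E → E} {η θ : E → E [⋀^Fin k]→L[ℝ] ℝ} {x : E} (hη : DifferentiableAt ℝ η x)
    (hθ : DifferentiableAt ℝ θ x) :
    lieDerivWithin X (η - θ) univ x = lieDerivWithin X η univ x - lieDerivWithin X θ univ x := by
  simp only [lieDerivWithin, fderivWithin_univ, fderiv_sub hη hθ, Pi.sub_apply,
    ← ContinuousAlternatingMap.fderivCompContinuousLinearMapCLM_apply, map_sub, _root_.sub_apply]
  abel

/-! ### Independence of the chart -/

section Charts

variable {E : Type*} [NormedAddCommGroup E] [NormedSpace ℝ E]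
  {H : Type*} [TopologicalSpace H] {I : ModelWithCorners ℝ E H}
  {M : Type*} [TopologicalSpace M] [ChartedSpace H M] {k : ℕ}

variable {x₀ x₁ x : M} {y : E}

theorem Form.inChart_sub (η θ : Form I M k) (x₀ : M) :
    Form.inChart (η - θ) x₀ = η.inChart x₀ - θ.inChart x₀ := rfl

theorem Form.inChart_add (η θ : Form I M k) (x₀ : M) :
    Form.inChart (η + θ) x₀ = η.inChart x₀ + θ.inChart x₀ := rfl

theorem Form.IsSmooth.sub {η θ : Form I M k} (hη : η.IsSmooth) (hθ : θ.IsSmooth) :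
    Form.IsSmooth (η - θ) :=
  fun x₀ => (hη x₀).sub (hθ x₀)

theorem Form.IsSmooth.add {η θ : Form I M k} (hη : η.IsSmooth) (hθ : θ.IsSmooth) :
    Form.IsSmooth (η + θ) :=
  fun x₀ => (hη x₀).add (hθ x₀)

theorem mapDeriv_id (x : M) : mapDeriv I id x = .id ℝ E := mfderiv_id

theorem symm_mem_source (x₀ : M) (y : E) :
    (extChartAt I x₀).symm y ∈ (extChartAt I ((extChartAt I x₀).symm y)).source :=
  mem_extChartAt_source _

theorem chartMap_mem_target {f : M → M}
    (hfy : f ((extChartAt I x₀).symm y) ∈ (extChartAt I x₁).source) :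
    chartMap I f x₀ x₁ y ∈ (extChartAt I x₁).target :=
  (extChartAt I x₁).map_source hfy

theorem formPullback_id (η : Form I M k) : formPullback id η = η := by
  funext x
  change (η.toFun x).compContinuousLinearMap (mapDeriv I id x) = η.toFun x
  rw [mapDeriv_id]
  rfl

theorem interiorProduct_inChart [IsManifold I 1 M] (X : VecField I M) (η : Form I M (k + 1))
    (hy : y ∈ (extChartAt I x₀).target) :
    (interiorProduct X η).inChart x₀ y = (η.inChart x₀ y).curryLeft (X.inChart x₀ y) := by
  rw [Form.inChart_eq, Form.inChart_eq, ContinuousAlternatingMap.curryLeft_compContinuousLinearMap,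
    symmDeriv_inChart X hy]
  rfl

variable [I.Boundaryless]

theorem target_mem_nhds (hy : y ∈ (extChartAt I x₀).target) : (extChartAt I x₀).target ∈ 𝓝 y :=
  (isOpen_extChartAt_target x₀).mem_nhds hy

theorem Form.isSmooth_iff {η : Form I M k} : η.IsSmooth ↔
    ∀ x₀ : M, ∀ y ∈ (extChartAt I x₀).target, ContDiffAt ℝ ∞ (η.inChart x₀) y :=
  forall_congr' fun _ => ⟨fun h _ hy => (h _ hy).contDiffAt (target_mem_nhds hy),
    fun h y hy => (h y hy).contDiffWithinAt⟩

theorem Form.IsSmooth.contDiffAt {η : Form I M k} (hη : η.IsSmooth)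
    (hy : y ∈ (extChartAt I x₀).target) : ContDiffAt ℝ ∞ (η.inChart x₀) y :=
  Form.isSmooth_iff.1 hη x₀ y hy

/-- Without boundary `range I` is the whole space, so derivatives within it are ordinary ones. -/
theorem extDer_eq (η : Form I M k) (x : M) : (extDer η).toFun x =
    (extDeriv (η.inChart x) (extChartAt I x x)).compContinuousLinearMap (chartDeriv I x x) := by
  rw [← extDerivWithin_univ, ← I.range_eq_univ]
  rfl

theorem lieDeriv_eq (X : VecField I M) (η : Form I M k) (x : M) : (lieDeriv X η).toFun x =
    (lieDerivWithin (X.inChart x) (η.inChart x) univ (extChartAt I x x)).compContinuousLinearMap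
      (chartDeriv I x x) := by
  rw [← I.range_eq_univ]
  rfl

variable [IsManifold I ∞ M]

theorem contMDiffAt_extChartAt_symm (hy : y ∈ (extChartAt I x₀).target) :
    ContMDiffAt 𝓘(ℝ, E) I ∞ (extChartAt I x₀).symm y :=
  (contMDiffOn_extChartAt_symm x₀).contMDiffAt (target_mem_nhds hy)


theorem contDiffAt_chartMap {f : M → M} (hf : ContMDiffAt I I ∞ f ((extChartAt I x₀).symm y))
    (hy : y ∈ (extChartAt I x₀).target)
    (hfy : f ((extChartAt I x₀).symm y) ∈ (extChartAt I x₁).source) :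
    ContDiffAt ℝ ∞ (chartMap I f x₀ x₁) y := by
  rw [← contMDiffAt_iff_contDiffAt]
  exact (contMDiffAt_extChartAt' (by rwa [extChartAt_source] at hfy)).comp y
    (hf.comp y (contMDiffAt_extChartAt_symm hy))

theorem eventually_mem_source_comp {f : M → M}
    (hf : ContMDiffAt I I ∞ f ((extChartAt I x₀).symm y)) (hy : y ∈ (extChartAt I x₀).target)
    (hfy : f ((extChartAt I x₀).symm y) ∈ (extChartAt I x₁).source) :
    ∀ᶠ z in 𝓝 y, z ∈ (extChartAt I x₀).target ∧
      f ((extChartAt I x₀).symm z) ∈ (extChartAt I x₁).source :=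
  (show ∀ᶠ z in 𝓝 y, z ∈ (extChartAt I x₀).target from target_mem_nhds hy).and
    ((hf.continuousAt.comp (f := (extChartAt I x₀).symm)
      (contMDiffAt_extChartAt_symm hy).continuousAt).eventually
      ((isOpen_extChartAt_source x₁).mem_nhds hfy))

theorem fderiv_transition (hy : y ∈ (extChartAt I x₀).target) :
    fderiv ℝ (chartMap I id x₀ ((extChartAt I x₀).symm y)) y =
      (chartDeriv I ((extChartAt I x₀).symm y) ((extChartAt I x₀).symm y)).comp
        (symmDeriv I x₀ y) := by
  rw [fderiv_chartMap mdifferentiableAt_id hy (symm_mem_source x₀ y), mapDeriv_id]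
  rfl

theorem inChart_eventuallyEq_pullback {f : M → M} (η : Form I M k) (hf : ContMDiff I I ∞ f)
    (hy : y ∈ (extChartAt I x₀).target)
    (hfy : f ((extChartAt I x₀).symm y) ∈ (extChartAt I x₁).source) :
    (formPullback f η).inChart x₀ =ᶠ[𝓝 y] fun z =>
      (η.inChart x₁ (chartMap I f x₀ x₁ z)).compContinuousLinearMap
        (fderiv ℝ (chartMap I f x₀ x₁) z) := by
  filter_upwards [eventually_mem_source_comp hf.contMDiffAt hy hfy] with z hz
  exact formPullback_inChart η (hf.mdifferentiable (by simp) _) hz.1 hz.2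

/-- The exterior derivative may be computed in any chart. -/
theorem extDer_inChart {η : Form I M k} (hη : η.IsSmooth) (hy : y ∈ (extChartAt I x₀).target) :
    (extDer η).inChart x₀ y = extDeriv (η.inChart x₀) y := by
  have hs := symm_mem_source (I := I) x₀ y
  -- Near `y`, the expression at `x₀` is the pullback, by the transition map, of the expression in
  -- the preferred chart of the point over `y`, the one defining `extDer` there.
  have h1 := inChart_eventuallyEq_pullback η contMDiff_id hy hs
  rw [formPullback_id] at h1
  have hF := contDiffAt_chartMap contMDiffAt_id hy hs
  have ht : chartMap I id x₀ ((extChartAt I x₀).symm y) y ∈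
    (extChartAt I ((extChartAt I x₀).symm y)).target := mem_extChartAt_target _
  rw [h1.extDeriv_eq, extDeriv_pullback ((hη.contDiffAt ht).differentiableAt (by simp)) hF
    minSmoothness_two_le, fderiv_transition hy, Form.inChart_eq, extDer_eq]
  rfl

theorem eventually_fderiv_chartMap_mpullback {f : M → M} (X : VecField I M) (hf : ContMDiff I I ∞ f)
    (hfi : ∀ x, (mapDeriv I f x).IsInvertible)
    (hy : y ∈ (extChartAt I x₀).target)
    (hfy : f ((extChartAt I x₀).symm y) ∈ (extChartAt I x₁).source) :
    ∀ᶠ z in 𝓝 y, fderiv ℝ (chartMap I f x₀ x₁) z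
      (VecField.inChart (VectorField.mpullback I I f X) x₀ z) =
        X.inChart x₁ (chartMap I f x₀ x₁ z) := by
  filter_upwards [eventually_mem_source_comp hf.contMDiffAt hy hfy] with z hz
  exact mpullback_inChart X (hf.mdifferentiable (by simp) _) (hfi _) hz.1 hz.2

variable [CompleteSpace E]

/-- The chart expression is the pullback by the inverse chart, a smooth section of the tangent
bundle of `E`; that bundle is trivial, so its fibre component is a smooth function. -/
theorem VecField.IsSmooth.contDiffAt {X : VecField I M} (hX : X.IsSmooth)
    (hy : y ∈ (extChartAt I x₀).target) : ContDiffAt ℝ ∞ (X.inChart x₀) y := by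
  have h := ContMDiffWithinAt.mpullbackWithin_vectorField_of_mem (s := range I) (t := univ)
    (f := (extChartAt I x₀).symm) (x₀ := y) (n := ∞) (m := ∞) (hX _).contMDiffWithinAt
    (contMDiffAt_extChartAt_symm hy).contMDiffWithinAt
    (isInvertible_mfderivWithin_extChartAt_symm hy) (by simp [I.range_eq_univ])
    I.uniqueMDiffOn le_rfl univ_mem
  rw [I.range_eq_univ, contMDiffWithinAt_univ] at h
  have h2 := (contMDiff_snd_tangentBundle_modelSpace E 𝓘(ℝ, E) (n := ∞)).contMDiffAt.comp y h
  rw [contMDiffAt_iff_contDiffAt] at h2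
  unfold VecField.inChart
  rw [I.range_eq_univ]
  exact h2

/-- The Lie derivative may be computed in any chart. -/
theorem lieDeriv_inChart {X : VecField I M} {η : Form I M k} (hX : X.IsSmooth) (hη : η.IsSmooth)
    (hy : y ∈ (extChartAt I x₀).target) :
    (lieDeriv X η).inChart x₀ y = lieDerivWithin (X.inChart x₀) (η.inChart x₀) univ y := by
  have hs := symm_mem_source (I := I) x₀ y
  have h1 := inChart_eventuallyEq_pullback η contMDiff_id hy hs
  -- The two chart expressions of `X` are related by the transition map, since `X` is its own
  -- pullback by `id`.
  have h2 := eventually_fderiv_chartMap_mpullback X contMDiff_id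
    (fun x => by rw [mapDeriv_id]; exact ⟨.refl ℝ E, rfl⟩) hy hs
  rw [formPullback_id] at h1
  rw [VectorField.mpullback_id] at h2
  have hF := contDiffAt_chartMap contMDiffAt_id hy hs
  have ht : chartMap I id x₀ ((extChartAt I x₀).symm y) y ∈
    (extChartAt I ((extChartAt I x₀).symm y)).target := mem_extChartAt_target _
  rw [lieDerivWithin_congr h1, lieDerivWithin_pullback ((hη.contDiffAt ht).differentiableAt (by simp))
    ((hX.contDiffAt ht).differentiableAt (by simp)) (hF.of_le (by norm_cast))
    ((hX.contDiffAt hy).differentiableAt (by simp)) h2, fderiv_transition hy, Form.inChart_eq,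
    lieDeriv_eq]
  rfl

/-- The bracket is natural under the inverse chart, and on `E` the manifold bracket is the flat one.
-/
theorem mlieBracket_inChart {X Y : VecField I M} (hX : X.IsSmooth) (hY : Y.IsSmooth)
    (hy : y ∈ (extChartAt I x₀).target) :
    VecField.inChart (VectorField.mlieBracket I X Y) x₀ y =
      VectorField.lieBracket ℝ (X.inChart x₀) (Y.inChart x₀) y := by
  have : IsManifold I (minSmoothness ℝ 2) M := .of_le minSmoothness_two_le
  have h := VectorField.mpullback_mlieBracket (I := 𝓘(ℝ, E)) (n := ∞) (f := (extChartAt I x₀).symm)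
    (x₀ := y) ((hX _).mdifferentiableAt (by simp)) ((hY _).mdifferentiableAt (by simp))
    (contMDiffAt_extChartAt_symm hy) minSmoothness_two_le
  rw [← VectorField.mlieBracketWithin_univ (I := 𝓘(ℝ, E)),
    VectorField.mlieBracketWithin_eq_lieBracketWithin] at h
  simp only [VecField.inChart, I.range_eq_univ, VectorField.mpullbackWithin_univ]
  exact h.trans (congrFun VectorField.lieBracketWithin_univ y)

end Charts

/-! ### Cartan calculus on the manifold and structure forms -/

section Calculus

variable {E : Type*} [NormedAddCommGroup E] [NormedSpace ℝ E]
  {H : Type*} [TopologicalSpace H] {I : ModelWithCorners ℝ E H}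
  {M : Type*} [TopologicalSpace M] [ChartedSpace H M] {k : ℕ}

theorem interiorProduct_zero (X : VecField I M) :
    interiorProduct X (0 : Form I M (k + 1)) = 0 := rfl

theorem isInvertible_mapDeriv (f : M ≃ₘ^∞⟮I, I⟯ M) (x : M) : (mapDeriv I f x).IsInvertible :=
  ⟨f.mfderivToContinuousLinearEquiv (by simp) x, rfl⟩

theorem VecField.IsSmooth.mpullback [IsManifold I ∞ M] [CompleteSpace E] {X : VecField I M}
    (hX : X.IsSmooth) (f : M ≃ₘ^∞⟮I, I⟯ M) :
    VecField.IsSmooth (VectorField.mpullback I I f X) :=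
  ContMDiff.mpullback_vectorField (n := ∞) hX f.contMDiff (isInvertible_mapDeriv f) le_rfl

theorem VecField.IsSmooth.mlieBracket [IsManifold I ∞ M] [CompleteSpace E] {X Y : VecField I M}
    (hX : X.IsSmooth) (hY : Y.IsSmooth) :
    VecField.IsSmooth (VectorField.mlieBracket I X Y) := fun x =>
  have : IsManifold I (minSmoothness ℝ 2) M := .of_le minSmoothness_two_le
  have : IsManifold I (((⊤ : ℕ∞) : ℕ∞ω) + 1) M := ‹IsManifold I ∞ M›
  ContMDiffAt.mlieBracket_vectorField (m := ⊤) (n := ⊤) (hX x) (hY x)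
    (by rw [minSmoothness_of_isRCLikeNormedField]; rfl)

variable [I.Boundaryless] [IsManifold I ∞ M]

/-- Chart independence is essential: the definition changes chart with the point, while smoothness
is tested in a fixed one. -/
theorem Form.IsSmooth.extDer {η : Form I M k} (hη : η.IsSmooth) : (extDer η).IsSmooth :=
  Form.isSmooth_iff.2 fun _ _ hy => (contDiffAt_extDeriv (hη.contDiffAt hy)).congr_of_eventuallyEq <|
    Filter.eventuallyEq_of_mem (target_mem_nhds hy) fun _ hz => extDer_inChart hη hz

theorem extDer_inChart_eventuallyEq {η : Form I M k} (hη : η.IsSmooth) {x₀ : M} {y : E}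
    (hy : y ∈ (extChartAt I x₀).target) :
    (extDer η).inChart x₀ =ᶠ[𝓝 y] extDeriv (η.inChart x₀) :=
  Filter.eventuallyEq_of_mem (target_mem_nhds hy) fun _ hz => extDer_inChart hη hz

theorem Form.IsSmooth.formPullback {η : Form I M k} (hη : η.IsSmooth) {f : M → M}
    (hf : ContMDiff I I ∞ f) : (formPullback f η).IsSmooth := by
  refine Form.isSmooth_iff.2 fun x₀ y hy => ?_
  have hs : f ((extChartAt I x₀).symm y) ∈
      (extChartAt I (f ((extChartAt I x₀).symm y))).source := mem_extChartAt_source _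
  have hF := contDiffAt_chartMap hf.contMDiffAt hy hs
  exact (contDiffAt_pullback (hη.contDiffAt (chartMap_mem_target hs)) hF
    (contDiffAt_infty_fderiv hF)).congr_of_eventuallyEq (inChart_eventuallyEq_pullback η hf hy hs)

theorem extDer_sub {η θ : Form I M k} (hη : η.IsSmooth) (hθ : θ.IsSmooth) :
    extDer (η - θ) = extDer η - extDer θ := by
  refine Form.ext_inChart fun x => ?_
  have hy := mem_extChartAt_target (I := I) x
  rw [extDer_inChart (hη.sub hθ) hy, Form.inChart_sub, Form.inChart_sub, Pi.sub_apply,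
    extDer_inChart hη hy, extDer_inChart hθ hy, extDeriv, extDeriv, extDeriv,
    fderiv_sub ((hη.contDiffAt hy).differentiableAt (by simp))
      ((hθ.contDiffAt hy).differentiableAt (by simp))]
  exact map_sub (ContinuousAlternatingMap.alternatizeUncurryFinCLM ℝ E ℝ) _ _

theorem extDer_add {η θ : Form I M k} (hη : η.IsSmooth) (hθ : θ.IsSmooth) :
    extDer (η + θ) = extDer η + extDer θ := by
  refine Form.ext_inChart fun x => ?_
  have hy := mem_extChartAt_target (I := I) x
  rw [extDer_inChart (hη.add hθ) hy, Form.inChart_add, Form.inChart_add, Pi.add_apply,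
    extDer_inChart hη hy, extDer_inChart hθ hy,
    extDeriv_add ((hη.contDiffAt hy).differentiableAt (by simp))
      ((hθ.contDiffAt hy).differentiableAt (by simp))]

theorem extDer_extDer {η : Form I M k} (hη : η.IsSmooth) : extDer (extDer η) = 0 := by
  refine Form.ext_inChart fun x => ?_
  have hy := mem_extChartAt_target (I := I) x
  rw [extDer_inChart hη.extDer hy, (extDer_inChart_eventuallyEq hη hy).extDeriv_eq,
    extDeriv_extDeriv_apply (hη.contDiffAt hy) minSmoothness_two_le]
  rfl

theorem extDer_formPullback {η : Form I M k} (hη : η.IsSmooth) {f : M → M}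
    (hf : ContMDiff I I ∞ f) : extDer (formPullback f η) = formPullback f (extDer η) := by
  refine Form.ext_inChart fun x => ?_
  have hy := mem_extChartAt_target (I := I) x
  have hs : f ((extChartAt I x).symm (extChartAt I x x)) ∈
      (extChartAt I (f ((extChartAt I x).symm (extChartAt I x x)))).source :=
    mem_extChartAt_source _
  have ht := chartMap_mem_target hs
  rw [extDer_inChart (hη.formPullback hf) hy, (inChart_eventuallyEq_pullback η hf hy hs).extDeriv_eq,
    extDeriv_pullback ((hη.contDiffAt ht).differentiableAt (by simp))
      (contDiffAt_chartMap hf.contMDiffAt hy hs) minSmoothness_two_le,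
    (inChart_eventuallyEq_pullback _ hf hy hs).self_of_nhds]
  exact congrArg (fun θ : E [⋀^Fin (k + 1)]→L[ℝ] ℝ => θ.compContinuousLinearMap _)
    (extDer_inChart hη ht).symm

theorem interiorProduct_inChart_eventuallyEq (X : VecField I M) (η : Form I M (k + 1)) {x₀ : M}
    {y : E} (hy : y ∈ (extChartAt I x₀).target) :
    (interiorProduct X η).inChart x₀ =ᶠ[𝓝 y]
      fun z => (η.inChart x₀ z).curryLeft (X.inChart x₀ z) :=
  Filter.eventuallyEq_of_mem (target_mem_nhds hy) fun _ hz => interiorProduct_inChart X η hz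

variable [CompleteSpace E]

theorem lieDeriv_inChart_eventuallyEq {X : VecField I M} {η : Form I M k} (hX : X.IsSmooth)
    (hη : η.IsSmooth) {x₀ : M} {y : E} (hy : y ∈ (extChartAt I x₀).target) :
    (lieDeriv X η).inChart x₀ =ᶠ[𝓝 y] lieDerivWithin (X.inChart x₀) (η.inChart x₀) univ :=
  Filter.eventuallyEq_of_mem (target_mem_nhds hy) fun _ hz => lieDeriv_inChart hX hη hz

theorem Form.IsSmooth.lieDeriv {X : VecField I M} {η : Form I M k} (hη : η.IsSmooth)
    (hX : X.IsSmooth) : (lieDeriv X η).IsSmooth :=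
  Form.isSmooth_iff.2 fun _ _ hy =>
    (contDiffAt_lieDerivWithin (hX.contDiffAt hy) (hη.contDiffAt hy)).congr_of_eventuallyEq
      (lieDeriv_inChart_eventuallyEq hX hη hy)

theorem Form.IsSmooth.interiorProduct {X : VecField I M} {η : Form I M (k + 1)} (hη : η.IsSmooth)
    (hX : X.IsSmooth) : (interiorProduct X η).IsSmooth :=
  Form.isSmooth_iff.2 fun _ _ hy =>
    (contDiffAt_curryLeft (hX.contDiffAt hy) (hη.contDiffAt hy)).congr_of_eventuallyEq
      (interiorProduct_inChart_eventuallyEq X η hy)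

/-- Cartan's formula. -/
theorem lieDeriv_eq_cartan {X : VecField I M} {η : Form I M (k + 1)} (hX : X.IsSmooth)
    (hη : η.IsSmooth) :
    lieDeriv X η = interiorProduct X (extDer η) + extDer (interiorProduct X η) := by
  refine Form.ext_inChart fun x => ?_
  have hy := mem_extChartAt_target (I := I) x
  rw [lieDeriv_inChart hX hη hy, Form.inChart_add, Pi.add_apply, interiorProduct_inChart _ _ hy,
    extDer_inChart hη hy, extDer_inChart (hη.interiorProduct hX) hy,
    (interiorProduct_inChart_eventuallyEq X η hy).extDeriv_eq,
    lieDerivWithin_univ_eq ((hX.contDiffAt hy).differentiableAt (by simp))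
      ((hη.contDiffAt hy).differentiableAt (by simp))]

theorem lieDeriv_zero_form {X : VecField I M} {η : Form I M 0} (hX : X.IsSmooth)
    (hη : η.IsSmooth) : lieDeriv X η = interiorProduct X (extDer η) := by
  refine Form.ext_inChart fun x => ?_
  have hy := mem_extChartAt_target (I := I) x
  rw [lieDeriv_inChart hX hη hy, interiorProduct_inChart _ _ hy, extDer_inChart hη hy,
    lieDerivWithin_univ_eq_zero_form]

/-- By Cartan's formula and `d² = 0`, both sides equal `d i_X dη`. Degree zero is separate because
`interiorProduct` needs positive degree. -/
theorem lieDeriv_extDer {X : VecField I M} {η : Form I M k} (hX : X.IsSmooth) (hη : η.IsSmooth) :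
    lieDeriv X (extDer η) = extDer (lieDeriv X η) := by
  rw [lieDeriv_eq_cartan hX hη.extDer, extDer_extDer hη, interiorProduct_zero, zero_add]
  cases k with
  | zero => rw [lieDeriv_zero_form hX hη]
  | succ k =>
    have h := hη.interiorProduct hX
    rw [lieDeriv_eq_cartan hX hη, extDer_add (hη.extDer.interiorProduct hX) h.extDer,
      extDer_extDer h, add_zero]

theorem lieDeriv_sub {X : VecField I M} {η θ : Form I M k} (hX : X.IsSmooth) (hη : η.IsSmooth)
    (hθ : θ.IsSmooth) : lieDeriv X (η - θ) = lieDeriv X η - lieDeriv X θ := by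
  refine Form.ext_inChart fun x => ?_
  have hy := mem_extChartAt_target (I := I) x
  rw [lieDeriv_inChart hX (hη.sub hθ) hy, Form.inChart_sub, Form.inChart_sub, Pi.sub_apply,
    lieDeriv_inChart hX hη hy, lieDeriv_inChart hX hθ hy, lieDerivWithin_sub
      ((hη.contDiffAt hy).differentiableAt (by simp))
      ((hθ.contDiffAt hy).differentiableAt (by simp))]

theorem lieDeriv_mlieBracket {X Y : VecField I M} {η : Form I M k} (hX : X.IsSmooth)
    (hY : Y.IsSmooth) (hη : η.IsSmooth) :
    lieDeriv (VectorField.mlieBracket I X Y) η =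
      lieDeriv X (lieDeriv Y η) - lieDeriv Y (lieDeriv X η) := by
  refine Form.ext_inChart fun x => ?_
  have hy := mem_extChartAt_target (I := I) x
  have h2 : (2 : ℕ∞ω) ≤ ∞ := by norm_cast
  rw [lieDeriv_inChart (hX.mlieBracket hY) hη hy, Form.inChart_sub, Pi.sub_apply,
    lieDeriv_inChart hX (hη.lieDeriv hY) hy, lieDeriv_inChart hY (hη.lieDeriv hX) hy,
    -- The outer Lie derivative differentiates the inner one, so the latter must be replaced on a
    -- neighbourhood, not just at the point.
    lieDerivWithin_congr (lieDeriv_inChart_eventuallyEq hY hη hy),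
    lieDerivWithin_congr (lieDeriv_inChart_eventuallyEq hX hη hy),
    ← lieDerivWithin_lieBracket ((hX.contDiffAt hy).of_le h2) ((hY.contDiffAt hy).of_le h2)
      ((hη.contDiffAt hy).of_le h2)]
  exact lieDerivWithin_congr_field <| Filter.eventuallyEq_of_mem (target_mem_nhds hy) fun _ hz =>
    mlieBracket_inChart hX hY hz

theorem lieDeriv_formPullback {X : VecField I M} {η : Form I M k} (hX : X.IsSmooth)
    (hη : η.IsSmooth) (f : M ≃ₘ^∞⟮I, I⟯ M) :
    lieDeriv (VectorField.mpullback I I f X) (formPullback f η) =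
      formPullback f (lieDeriv X η) := by
  refine Form.ext_inChart fun x => ?_
  have hy := mem_extChartAt_target (I := I) x
  have hf := f.contMDiff
  have hs : f ((extChartAt I x).symm (extChartAt I x x)) ∈
      (extChartAt I (f ((extChartAt I x).symm (extChartAt I x x)))).source :=
    mem_extChartAt_source _
  have ht := chartMap_mem_target hs
  rw [lieDeriv_inChart (hX.mpullback f) (hη.formPullback hf) hy,
    lieDerivWithin_congr (inChart_eventuallyEq_pullback η hf hy hs),
    lieDerivWithin_pullback ((hη.contDiffAt ht).differentiableAt (by simp))
      ((hX.contDiffAt ht).differentiableAt (by simp))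
      ((contDiffAt_chartMap hf.contMDiffAt hy hs).of_le (by norm_cast))
      (((hX.mpullback f).contDiffAt hy).differentiableAt (by simp))
      (eventually_fderiv_chartMap_mpullback X hf (isInvertible_mapDeriv f) hy hs),
    (inChart_eventuallyEq_pullback _ hf hy hs).self_of_nhds]
  exact congrArg (fun θ : E [⋀^Fin k]→L[ℝ] ℝ => θ.compContinuousLinearMap _)
    (lieDeriv_inChart hX hη ht).symm

/-- A smooth vector field with a structure form is exact incompressible. -/
theorem IsStructureForm.isExactIncompressible {α : Form I M (k + 1)} {X : VecField I M}
    {β : Form I M k} (h : IsStructureForm α X β) (hα : α.IsSmooth) (hX : X.IsSmooth) :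
    IsExactIncompressible (extDer α) X := by
  have hi := hα.interiorProduct hX
  -- The primitive is read off from Cartan's formula: `i_X dα = L_X α - d i_X α`.
  refine ⟨hX, β - interiorProduct X α, h.1.sub hi, ?_⟩
  rw [extDer_sub h.1 hi, ← h.2, lieDeriv_eq_cartan hX hα, add_sub_cancel_right]

theorem IsStructureForm.mlieBracket {α : Form I M (k + 1)} {X Y : VecField I M}
    {βX βY : Form I M k} (hα : α.IsSmooth) (hX : X.IsSmooth) (hY : Y.IsSmooth)
    (hβX : IsStructureForm α X βX) (hβY : IsStructureForm α Y βY) :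
    IsStructureForm α (VectorField.mlieBracket I X Y) (lieDeriv X βY - lieDeriv Y βX) := by
  have h1 := hβY.1.lieDeriv hX
  have h2 := hβX.1.lieDeriv hY
  refine ⟨h1.sub h2, ?_⟩
  rw [lieDeriv_mlieBracket hX hY hα, hβX.2, hβY.2, lieDeriv_extDer hX hβY.1,
    lieDeriv_extDer hY hβX.1, extDer_sub h1 h2]

theorem IsStructureForm.mpullback {α : Form I M (k + 1)} {Z : VecField I M} {βZ l : Form I M k}
    {f : M ≃ₘ^∞⟮I, I⟯ M} (hα : α.IsSmooth) (hZ : Z.IsSmooth) (hβ : IsStructureForm α Z βZ)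
    (hf : IsExactVolumePreserving α f l) :
    IsStructureForm α (VectorField.mpullback I I f Z)
      (formPullback f βZ - lieDeriv (VectorField.mpullback I I f Z) l) := by
  have hW := hZ.mpullback f
  have h1 := hβ.1.formPullback f.contMDiff
  have h2 := hf.1.lieDeriv hW
  refine ⟨h1.sub h2, ?_⟩
  -- With `W = f^*Z`, the right side becomes `L_W f^*α - L_W dλ`; substituting `dλ = f^*α - α`
  -- leaves `L_W α`.
  rw [extDer_sub h1 h2, extDer_formPullback hβ.1 f.contMDiff, ← hβ.2, ← lieDeriv_formPullback hZ hα,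
    ← lieDeriv_extDer hW hf.1, ← hf.2, lieDeriv_sub hW (hα.formPullback f.contMDiff) hα,
    sub_sub_cancel]

end Calculus

end ExactVol

end

/-! ### The theorem in dimension `n = k + 2`, which encodes `n ≥ 2` and gives structure forms degree
`k` -/

theorem mainTheorem7 (k : ℕ) (M : Type*) [TopologicalSpace M]
    [ChartedSpace (EuclideanSpace ℝ (Fin (k + 2))) M] [IsManifold (𝓡 (k + 2)) ∞ M]
    (Ω : Form (𝓡 (k + 2)) M (k + 2)) (α : Form (𝓡 (k + 2)) M (k + 1))
    (hΩ : IsVolumeForm Ω) (hα : α.IsSmooth) (hαΩ : extDer α = Ω) :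
    (∀ (X Y : VecField (𝓡 (k + 2)) M) (βX βY : Form (𝓡 (k + 2)) M k),
      IsExactIncompressible Ω X → IsStructureForm α X βX →
      IsExactIncompressible Ω Y → IsStructureForm α Y βY →
        IsExactIncompressible Ω (VectorField.mlieBracket (𝓡 (k + 2)) X Y) ∧
        IsStructureForm α (VectorField.mlieBracket (𝓡 (k + 2)) X Y)
          (lieDeriv X βY - lieDeriv Y βX)) ∧
    (∀ (Z : VecField (𝓡 (k + 2)) M) (βZ : Form (𝓡 (k + 2)) M k)
      (f : M ≃ₘ^∞⟮𝓡 (k + 2), 𝓡 (k + 2)⟯ M) (l : Form (𝓡 (k + 2)) M k),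
      IsExactIncompressible Ω Z → IsStructureForm α Z βZ → IsExactVolumePreserving α f l →
        IsExactIncompressible Ω (VectorField.mpullback (𝓡 (k + 2)) (𝓡 (k + 2)) f Z) ∧
        IsStructureForm α (VectorField.mpullback (𝓡 (k + 2)) (𝓡 (k + 2)) f Z)
          (formPullback f βZ -
            lieDeriv (VectorField.mpullback (𝓡 (k + 2)) (𝓡 (k + 2)) f Z) l)) := by
  subst hαΩ
  refine ⟨fun X Y βX βY hX hβX hY hβY => ?_, fun Z βZ f l hZ hβZ hf => ?_⟩
  · have h := IsStructureForm.mlieBracket hα hX.1 hY.1 hβX hβY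
    exact ⟨h.isExactIncompressible hα (hX.1.mlieBracket hY.1), h⟩
  · have h := IsStructureForm.mpullback hα hZ.1 hβZ hf
    exact ⟨h.isExactIncompressible hα (hZ.1.mpullback f), h⟩
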